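/- All vector lattices are real. For a vector lattice $F$ write $e\perp f$ if $|e|\wedge|f|=0$, and for $G\subset F$ let $G^{d}=\{f\in F:\ f\perp g\ \text{for all } g\in G\}$ and $G^{dd}=(G^d)^d$. $F$ is Archimedean if $\frac1n f\downarrow 0$ for every $f\in F_+$. A net $(f_i)$ order converges to $f$ if there is a net $g_j\downarrow 0$ such that for every $j$ there is $i$ with $|f-f_k|\le g_j$ for all $k\ge i$; a linear map is order continuous if it preserves order convergence of nets. A sublattice of $F$ is a linear subspace closed under the lattice operations. A sublattice $H$ is regular in $F$ if, whenever a nonempty $G\subset H$ has a supremum in $H$, this is also its supremum in $F$; it is order dense if for every $f>0$ in $F$ there is $e\in H$ with $0<e\le f$; it is an ideal if $0\le f\le e\in H$ implies $f\in H$. A band is an ideal closed under order convergence of nets. For $f\in F_+$ let $F_f=\{g\in F:\ |g|\le\alpha f\ \text{for some real } \alpha\ge 0\}$; $F$ has the $\sigma$-property if every sequence in $F$ is contained in some $F_f$ with $f\in F_+$. A homomorphism is a linear map preserving the lattice operations. **Theorem.** Let $T:F\to E$ be a homomorphism between Archimedean vector lattices. The following conditions are equivalent: (i) $T$ is order continuous;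 (ii) $T$ preserves suprema of arbitrary nonempty sets, i.e. if $\emptyset\ne G\subset F$ and $g=\sup G$ exists, then $Tg=\sup TG$; (iii) $\operatorname{Ker} T$ is a band in $F$ and $TF$ is a regular sublattice of $E$; (iv) $T^{-1}H$ is a band in $F$ for every band $H$ in $E$; (v) $T(G^{dd})\subset (TG)^{dd}$ for every subset $G\subset F$; (v$'$) $T(G^{dd})\subset (TG)^{dd}$ for every ideal $G$ of $F$. If additionally there is $f\in F_+$ with $\dim TF_f=\infty$, then these conditions are also equivalent to each of the following: (vi) $TH$ is a regular sublattice of $E$ for every regular sublattice $H$ of $F$; (vi$'$) $TH$ is a regular sublattice of $E$ for every order dense sublattice $H$ of $F$. Moreover, if $F$ has the $\sigma$-property and $\dim TF=\infty$, then there is $f\in F_+$ with $\dim TF_f=\infty$. -/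

import Mathlib

/-!
# Vector lattices: order convergence, sublattices, bands, order continuity

A (real) vector lattice is a type `F` with
`[AddCommGroup F] [Lattice F] [IsOrderedAddMonoid F] [Module ℝ F] [IsOrderedModule ℝ F]`.
-/

namespace VectorLattice

universe u v w

section Basic

variable {F : Type u} [AddCommGroup F] [Lattice F]

/-- A vector lattice is Archimedean if `(1/n) f ↓ 0` for every `f ≥ 0`.
(This is not Mathlib's class `Archimedean`, which asks every positive element to be
a strong unit.) -/
def IsArchimedean (F : Type u) [AddCommGroup F] [Lattice F] [Module ℝ F] : Prop :=
  ∀ f : F, 0 ≤ f → IsGLB (Set.range fun n : ℕ => ((1 : ℝ) / ((n : ℝ) + 1)) • f) 0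

/-- The disjoint complement `G^d` of a subset `G`. -/
def disjointCompl (G : Set F) : Set F := {f | ∀ g ∈ G, |f| ⊓ |g| = 0}

/-- Order convergence of the net `f` (indexed by a directed set `I`) to `x`: there is a net
`g j ↓ 0` such that for every `j` the elements `|x - f k|` are eventually below `g j`.
Replacing `g` by its range, indexed by itself, shows that it is harmless to take the index set `J`
in the universe of `F`. -/
def OrderConverges {I : Type w} [Preorder I] (f : I → F) (x : F) : Prop :=
  ∃ (J : Type u) (_ : Preorder J) (_ : IsDirectedOrder J) (_ : Nonempty J) (g : J → F),
    Antitone g ∧ IsGLB (Set.range g) 0 ∧ ∀ j, ∃ i, ∀ k, i ≤ k → |x - f k| ≤ g j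

section Subspaces

variable [Module ℝ F]

/-- A linear subspace closed under the lattice operations. -/
structure IsSublattice (H : Submodule ℝ F) : Prop where
  sup_mem : ∀ ⦃x⦄, x ∈ H → ∀ ⦃y⦄, y ∈ H → x ⊔ y ∈ H
  inf_mem : ∀ ⦃x⦄, x ∈ H → ∀ ⦃y⦄, y ∈ H → x ⊓ y ∈ H

/-- A sublattice is regular if the supremum in `H` of any nonempty subset `G` of `H` that has one is
also the supremum of `G` in `F`. (An element of `H` that is the supremum of `G` in `F` is trivially
the supremum of `G` in `H`.) -/
structure IsRegularSublattice (H : Submodule ℝ F) : Prop extends IsSublattice H where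
  isLUB_coe : ∀ (G : Set H), G.Nonempty → ∀ g : H, IsLUB G g →
    IsLUB ((fun x : H => (x : F)) '' G) (g : F)

/-- A sublattice is order dense if below every `f > 0` it has some `e > 0`. -/
structure IsOrderDense (H : Submodule ℝ F) : Prop extends IsSublattice H where
  exists_le : ∀ f : F, 0 < f → ∃ e ∈ H, 0 < e ∧ e ≤ f

/-- An (order) ideal: a sublattice `H` such that `0 ≤ f ≤ e ∈ H` implies `f ∈ H`. -/
structure IsIdeal (H : Submodule ℝ F) : Prop extends IsSublattice H where
  mem_of_le : ∀ ⦃f e : F⦄, 0 ≤ f → f ≤ e → e ∈ H → f ∈ H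

/-- A band: an ideal closed under order convergence of nets. Order convergence depends only on
the collection of the sets `{f k | k ≥ i}`, so nets indexed in the universe of `F` suffice. -/
structure IsBand (H : Submodule ℝ F) : Prop extends IsIdeal H where
  mem_of_orderConverges : ∀ (I : Type u) [Preorder I] [IsDirectedOrder I] [Nonempty I]
    (f : I → F) (x : F), (∀ i, f i ∈ H) → OrderConverges f x → x ∈ H

variable [IsOrderedModule ℝ F]

theorem abs_smul_le (c : ℝ) (x : F) : |c • x| ≤ |c| • |x| := by
  have hx : x ≤ |x| := le_abs_self x
  have hx' : -x ≤ |x| := neg_le_abs x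
  have key : ∀ a : ℝ, 0 ≤ a → ∀ y : F, |a • y| ≤ a • |y| := fun a ha y =>
    abs_le'.2 ⟨smul_le_smul_of_nonneg_left (le_abs_self y) ha, by
      rw [← smul_neg]; exact smul_le_smul_of_nonneg_left (neg_le_abs y) ha⟩
  rcases le_total 0 c with hc | hc
  · rw [abs_of_nonneg hc]; exact key c hc x
  · rw [abs_of_nonpos hc]
    have h := key (-c) (neg_nonneg.2 hc) x
    rwa [neg_smul, abs_neg] at h

variable [IsOrderedAddMonoid F]

/-- The principal ideal `F_e = {f | ∃ a ≥ 0, |f| ≤ a |e|}`; for `e ≥ 0` this is the union of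
the sets `a [-e, e]`, `a ≥ 0`. -/
def principalIdeal (e : F) : Submodule ℝ F where
  carrier := {f | ∃ a : ℝ, 0 ≤ a ∧ |f| ≤ a • |e|}
  zero_mem' := ⟨0, le_rfl, by simp⟩
  add_mem' := by
    rintro x y ⟨a, ha, hx⟩ ⟨b, hb, hy⟩
    refine ⟨a + b, add_nonneg ha hb, (abs_add_le x y).trans ?_⟩
    rw [add_smul]
    exact add_le_add hx hy
  smul_mem' := by
    rintro c x ⟨a, ha, hx⟩
    refine ⟨|c| * a, mul_nonneg (abs_nonneg c) ha, (abs_smul_le c x).trans ?_⟩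
    rw [mul_smul]
    exact smul_le_smul_of_nonneg_left hx (abs_nonneg c)

/-- The σ-property: every sequence is contained in a principal ideal. -/
def HasSigmaProperty (F : Type u) [AddCommGroup F] [Lattice F] [Module ℝ F]
    [IsOrderedAddMonoid F] [IsOrderedModule ℝ F] : Prop :=
  ∀ f : ℕ → F, ∃ e : F, 0 ≤ e ∧ ∀ n, f n ∈ principalIdeal e

end Subspaces

end Basic

section Maps

variable {F : Type u} [AddCommGroup F] [Lattice F] [Module ℝ F]
variable {E : Type v} [AddCommGroup E] [Lattice E] [Module ℝ E]

/-- Vector lattice homomorphisms: linear maps preserving the lattice operations. -/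
structure IsLatticeHom (T : F →ₗ[ℝ] E) : Prop where
  map_sup : ∀ x y, T (x ⊔ y) = T x ⊔ T y
  map_inf : ∀ x y, T (x ⊓ y) = T x ⊓ T y

/-- `T` is order continuous if it preserves order convergence of nets (as for bands, nets indexed in
the universe of `F` suffice). -/
def IsOrderContinuous (T : F →ₗ[ℝ] E) : Prop :=
  ∀ (I : Type u) [Preorder I] [IsDirectedOrder I] [Nonempty I] (f : I → F) (x : F),
    OrderConverges f x → OrderConverges (fun i => T (f i)) (T x)

/-- `T` preserves every existing supremum of a nonempty set. -/
def PreservesSuprema (T : F →ₗ[ℝ] E) : Prop :=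
  ∀ (G : Set F), G.Nonempty → ∀ g : F, IsLUB G g → IsLUB (T '' G) (T g)

end Maps

end VectorLattice

open VectorLattice

/-!
All conditions of the first group revolve around preservation of suprema, which for a linear map may
be tested on sets `G` with infimum `0` (`preservesSuprema_iff_isGLB_zero`). Likewise an ideal is a
band exactly when it is closed under existing suprema (`isBand_of_mem_of_isLUB`), so nets only
appear when order continuity itself is compared with preservation of suprema.

A homomorphism `T` that preserves suprema maps regular sublattices to regular ones
(`PreservesSuprema.isRegularSublattice_map`), because the set of positive preimages in `H` of a set
with infimum `0` in `T H` has infimum `0` in `H`, by the Archimedean property. Conversely, if the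
kernel is a band, infima `0` in `F` are mapped to infima `0` in `T F`, and regularity of `T F` carries
them over to `E` (`preservesSuprema_of_isBand_ker`). Preservation of suprema also makes preimages of
bands bands, and since bands coincide with their second disjoint complements
(`IsBand.disjointCompl_disjointCompl_subset`), `T (G^{dd}) ⊆ (T G)^{dd}`. The way back, from this
inclusion for ideals, is `preservesSuprema_of_image_disjointCompl_subset`: a positive lower bound `e`
of `T G` yields elements `(e - ε T a)⁺` that are both in `(T I)^d` and dominated by an element of
`(T I)^{dd}` for a suitable ideal `I`, hence vanish.

For the second group, suppose that `T` maps order dense sublattices to regular ones but its kernel is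
not a band, and choose `f₀ ≥ 0` outside `Ker T` in `(Ker T)^{dd}`. An infinite-dimensional principal ideal
contains a disjoint sequence (`exists_disjoint_sequence`), which provides `0 < u ≤ k T f₀`, an
element `d ≥ 0` of `T F` disjoint from `u`, and disjoint `0 < w n ≤ d` in `T F`. Let `I` consist of
the elements of `T F` disjoint from `u` and from almost all `w n`. The sublattice `I + ℝ (d + u)` is
not regular, since in it the supremum of `I ∩ [0, d]` is `d + u`
(`not_isRegularSublattice_eventuallyDisjoint_sup_span`), but its preimage is order dense
(`isOrderDense_comap_of_eventuallyDisjoint_le`), because every `x > 0` in `F` either dominates a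
positive element of the kernel or is disjoint from `f₀`, so that `T x` is disjoint from `u`.
-/

set_option linter.unusedSectionVars false

namespace VectorLattice

/-! ### Disjointness in vector lattices -/

section LatticeGroup

variable {F : Type*} [AddCommGroup F] [Lattice F] [IsOrderedAddMonoid F]

theorem eq_zero_of_abs_le_zero {x : F} (h : |x| ≤ 0) : x = 0 :=
  le_antisymm ((le_abs_self x).trans h) (neg_nonpos.1 ((neg_le_abs x).trans h))

theorem add_inf_le_inf_add_inf {a b c : F} (ha : 0 ≤ a) (hb : 0 ≤ b) (hc : 0 ≤ c) :
    (a + b) ⊓ c ≤ a ⊓ c + b ⊓ c := by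
  rw [inf_add, add_inf, add_inf]
  refine le_inf (le_inf inf_le_left ?_) (le_inf ?_ ?_)
  · exact inf_le_right.trans (le_add_of_nonneg_left ha)
  · exact inf_le_right.trans (le_add_of_nonneg_right hb)
  · exact inf_le_right.trans (le_add_of_nonneg_left hc)

theorem inf_abs_eq_zero_of_le {x y z : F} (h : |y| ⊓ |z| = 0) (hxy : |x| ≤ |y|) :
    |x| ⊓ |z| = 0 :=
  le_antisymm ((inf_le_inf_right _ hxy).trans h.le) (le_inf (abs_nonneg _) (abs_nonneg _))

theorem add_inf_abs_eq_zero {x y z : F} (hx : |x| ⊓ |z| = 0) (hy : |y| ⊓ |z| = 0) :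
    |x + y| ⊓ |z| = 0 := by
  refine le_antisymm ?_ (le_inf (abs_nonneg _) (abs_nonneg _))
  calc |x + y| ⊓ |z| ≤ (|x| + |y|) ⊓ |z| := inf_le_inf_right _ (abs_add_le x y)
    _ ≤ |x| ⊓ |z| + |y| ⊓ |z| :=
      add_inf_le_inf_add_inf (abs_nonneg _) (abs_nonneg _) (abs_nonneg _)
    _ = 0 := by rw [hx, hy, add_zero]

theorem inf_posPart_sub_eq_zero {a b : F} : (a - b)⁺ ⊓ (b - a)⁺ = 0 := by
  have h := posPart_inf_negPart_eq_zero (a - b)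
  rwa [← posPart_neg, neg_sub] at h

theorem posPart_sub_le_self {a b : F} (ha : 0 ≤ a) (hb : 0 ≤ b) : (a - b)⁺ ≤ a :=
  sup_le (sub_le_self a hb) ha

/-- An element below `e` and disjoint from `w` is below `(e - w)⁺`. -/
theorem le_posPart_sub_of_inf_eq_zero {v w e : F} (hv : v ≤ e) (h : v ⊓ w = 0) :
    v ≤ (e - w)⁺ := by
  have h1 : v + w = v ⊔ w := by rw [← inf_add_sup v w, h, zero_add]
  have h2 : (e - w)⁺ = e ⊔ w - w := by rw [posPart_def, sup_sub, sub_self]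
  rw [h2, le_sub_iff_add_le, h1]
  exact sup_le_sup_right hv w

theorem isGLB_image_sub_iff {G : Set F} {g : F} :
    IsGLB ((fun x => g - x) '' G) 0 ↔ IsLUB G g := by
  constructor
  · intro h
    refine ⟨fun x hx => sub_nonneg.1 (h.1 ⟨x, hx, rfl⟩), fun u hu => ?_⟩
    have : g - u ≤ 0 := h.2 (by
      rintro _ ⟨x, hx, rfl⟩
      exact sub_le_sub_left (hu hx) g)
    exact sub_nonpos.1 this
  · intro h
    refine ⟨?_, fun u hu => ?_⟩
    · rintro _ ⟨x, hx, rfl⟩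
      exact sub_nonneg.2 (h.1 hx)
    · have : g ≤ g - u := h.2 fun x hx => by
        have h1 : u ≤ g - x := hu ⟨x, hx, rfl⟩
        exact le_sub_comm.1 h1
      exact (le_sub_self_iff g).1 this

end LatticeGroup

section VectorSpace

variable {F : Type*} [AddCommGroup F] [Lattice F] [IsOrderedAddMonoid F] [Module ℝ F]
  [IsOrderedModule ℝ F]

theorem abs_smul_eq (c : ℝ) (x : F) : |c • x| = |c| • |x| := by
  refine le_antisymm (abs_smul_le c x) ?_
  rcases eq_or_ne c 0 with rfl | hc
  · simp
  · have h := abs_smul_le c⁻¹ (c • x)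
    rw [smul_smul, inv_mul_cancel₀ hc, one_smul] at h
    have h2 := smul_le_smul_of_nonneg_left h (abs_nonneg c)
    rwa [smul_smul, abs_inv, mul_inv_cancel₀ (abs_ne_zero.2 hc), one_smul] at h2

theorem smul_inf_abs_eq_zero {x z : F} (c : ℝ) (hx : |x| ⊓ |z| = 0) : |c • x| ⊓ |z| = 0 := by
  obtain ⟨n, hn⟩ := exists_nat_ge |c|
  have key : ∀ n : ℕ, |(n : ℝ) • x| ⊓ |z| = 0 := by
    intro n
    induction n with
    | zero => simp
    | succ n ih =>
      rw [Nat.cast_succ, add_smul, one_smul]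
      exact add_inf_abs_eq_zero ih hx
  refine inf_abs_eq_zero_of_le (key n) ?_
  rw [abs_smul_eq, abs_smul_eq, Nat.abs_cast]
  exact smul_le_smul_of_nonneg_right hn (abs_nonneg x)

theorem IsArchimedean.le_zero_of_forall_smul_le (hF : IsArchimedean F) {x e : F}
    (h : ∀ ε : ℝ, 0 < ε → x ≤ ε • e) : x ≤ 0 := by
  have he : x ≤ |e| := (h 1 one_pos).trans (by rw [one_smul]; exact le_abs_self e)
  refine (hF |e| (abs_nonneg e)).2 ?_
  rintro _ ⟨n, rfl⟩
  exact (h _ (by positivity)).trans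
    (smul_le_smul_of_nonneg_left (le_abs_self e) (by positivity))

theorem IsArchimedean.le_zero_of_forall_nsmul_le (hF : IsArchimedean F) {x e : F}
    (h : ∀ n : ℕ, (n : ℝ) • x ≤ e) : x ≤ 0 := by
  have he : 0 ≤ e := by simpa using h 0
  refine (hF e he).2 ?_
  rintro _ ⟨n, rfl⟩
  have h1 := smul_le_smul_of_nonneg_left (h (n + 1))
    (show (0 : ℝ) ≤ 1 / ((n : ℝ) + 1) by positivity)
  rwa [smul_smul, Nat.cast_succ, one_div, inv_mul_cancel₀ (by positivity), one_smul,
    ← one_div] at h1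

/-! ### Ideals, bands and disjoint complements -/

/-- The disjoint complement of `G`, as a linear subspace. -/
def disjointComplSubmodule (G : Set F) : Submodule ℝ F where
  carrier := disjointCompl G
  zero_mem' := fun g _ => by simp
  add_mem' := fun hx hy g hg => add_inf_abs_eq_zero (hx g hg) (hy g hg)
  smul_mem' := fun c _ hx g hg => smul_inf_abs_eq_zero c (hx g hg)

theorem IsSublattice.abs_mem {H : Submodule ℝ F} (hH : IsSublattice H) {x : F} (hx : x ∈ H) :
    |x| ∈ H :=
  hH.sup_mem hx (H.neg_mem hx)

theorem IsSublattice.posPart_mem {H : Submodule ℝ F} (hH : IsSublattice H) {x : F}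
    (hx : x ∈ H) : x⁺ ∈ H :=
  hH.sup_mem hx H.zero_mem

theorem isSublattice_of_posPart_mem {H : Submodule ℝ F} (h : ∀ x ∈ H, x⁺ ∈ H) :
    IsSublattice H where
  sup_mem x hx y hy := by
    rw [sup_eq_add_posPart_sub]
    exact H.add_mem hy (h _ (H.sub_mem hx hy))
  inf_mem x hx y hy := by
    rw [inf_eq_sub_posPart_sub]
    exact H.sub_mem hx (h _ (H.sub_mem hx hy))

theorem IsIdeal.mem_of_abs_le {H : Submodule ℝ F} (hH : IsIdeal H) {x y : F} (hy : y ∈ H)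
    (h : |x| ≤ |y|) : x ∈ H := by
  have h1 : x⁺ ∈ H := hH.mem_of_le (posPart_nonneg x)
    ((sup_le (le_abs_self x) (abs_nonneg x)).trans h) (hH.abs_mem hy)
  have h2 : x⁻ ∈ H := hH.mem_of_le (negPart_nonneg x)
    ((sup_le (neg_le_abs x) (abs_nonneg x)).trans h) (hH.abs_mem hy)
  rw [← posPart_sub_negPart x]
  exact H.sub_mem h1 h2

theorem isIdeal_of_mem_of_abs_le {H : Submodule ℝ F}
    (h : ∀ x y : F, y ∈ H → |x| ≤ |y| → x ∈ H) : IsIdeal H where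
  toIsSublattice := isSublattice_of_posPart_mem fun x hx => h _ _ hx (by
    rw [abs_of_nonneg (posPart_nonneg x)]
    exact sup_le (le_abs_self x) (abs_nonneg x))
  mem_of_le f e hf hfe he := h f e he (by
    rw [abs_of_nonneg hf]
    exact hfe.trans (le_abs_self e))

theorem IsBand.mem_of_isLUB {H : Submodule ℝ F} (hH : IsBand H) {G : Set F} (hne : G.Nonempty)
    (hG : ∀ x ∈ G, x ∈ H) {g : F} (hg : IsLUB G g) : g ∈ H := by
  have hsub : supClosure G ⊆ (H : Set F) :=
    supClosure_min hG fun x hx y hy => hH.sup_mem hx hy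
  have hd : IsDirectedOrder (supClosure G) := ⟨fun a b =>
    ⟨⟨a.1 ⊔ b.1, supClosed_supClosure a.2 b.2⟩, le_sup_left, le_sup_right⟩⟩
  have hn : Nonempty (supClosure G) := hne.to_subtype.map fun x => ⟨x.1, subset_supClosure x.2⟩
  have hlub : IsLUB (supClosure G) g := isLUB_supClosure.2 hg
  refine hH.mem_of_orderConverges (supClosure G) (fun x => x.1) g (fun i => hsub i.2)
    ⟨supClosure G, inferInstance, hd, hn, fun x => g - x.1, ?_, ?_, fun j => ⟨j, fun k hk => ?_⟩⟩
  · intro a b hab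
    exact sub_le_sub_left (show a.1 ≤ b.1 from hab) g
  · have := isGLB_image_sub_iff.2 hlub
    rwa [Set.image_eq_range] at this
  · rw [abs_of_nonneg (sub_nonneg.2 (hlub.1 k.2))]
    exact sub_le_sub_left (show j.1 ≤ k.1 from hk) g

/-- An ideal closed under existing suprema of sets of positive elements is a band. This frees the
notion of a band from the choice of index sets of nets. -/
theorem isBand_of_mem_of_isLUB {H : Submodule ℝ F} (hH : IsIdeal H)
    (h : ∀ G : Set F, G.Nonempty → (∀ x ∈ G, x ∈ H ∧ 0 ≤ x) → ∀ g, IsLUB G g → g ∈ H) :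
    IsBand H where
  toIsIdeal := hH
  mem_of_orderConverges I _ _ _ f x hf hx := by
    obtain ⟨J, _, _, _, g, -, hg, hconv⟩ := hx
    have hlub : IsLUB (Set.range fun j => (|x| - g j)⁺) |x| := by
      refine ⟨?_, fun u hu => ?_⟩
      · rintro _ ⟨j, rfl⟩
        exact posPart_sub_le_self (abs_nonneg x) (hg.1 ⟨j, rfl⟩)
      · have : |x| - u ≤ 0 := hg.2 (by
          rintro _ ⟨j, rfl⟩
          exact sub_le_comm.1 ((le_posPart _).trans (hu ⟨j, rfl⟩)))
        exact sub_nonpos.1 this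
    have hmem : |x| ∈ H := by
      refine h _ (Set.range_nonempty _) ?_ _ hlub
      rintro _ ⟨j, rfl⟩
      obtain ⟨i, hi⟩ := hconv j
      refine ⟨hH.mem_of_abs_le (hf i) ?_, posPart_nonneg _⟩
      rw [abs_of_nonneg (posPart_nonneg _)]
      refine sup_le ?_ (abs_nonneg _)
      rw [sub_le_iff_le_add]
      calc |x| = |f i + (x - f i)| := by rw [add_sub_cancel]
        _ ≤ |f i| + |x - f i| := abs_add_le _ _
        _ ≤ |f i| + g j := by gcongr; exact hi i le_rfl
    exact hH.mem_of_abs_le hmem (by rw [abs_abs])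

theorem isBand_disjointComplSubmodule (G : Set F) : IsBand (disjointComplSubmodule G) := by
  refine isBand_of_mem_of_isLUB (isIdeal_of_mem_of_abs_le fun x y hy hxy z hz =>
    inf_abs_eq_zero_of_le (hy z hz) hxy) ?_
  intro A hne hA g hg z hz
  obtain ⟨a, ha⟩ := hne
  have hg0 : 0 ≤ g := (hA a ha).2.trans (hg.1 ha)
  set c := |g| ⊓ |z| with hc
  have hc0 : 0 ≤ c := le_inf (abs_nonneg _) (abs_nonneg _)
  -- `x ∈ A` and `c` are disjoint and lie below `g`, so that `x + c = x ⊔ c ≤ g`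
  have h1 : g ≤ g - c := hg.2 fun x hx => by
    have hx0 : x ⊓ c = 0 := by
      refine le_antisymm ?_ (le_inf (hA x hx).2 hc0)
      have := (hA x hx).1 z hz
      rw [abs_of_nonneg (hA x hx).2] at this
      exact (inf_le_inf_left x inf_le_right).trans this.le
    rw [le_sub_iff_add_le, ← inf_add_sup x c, hx0, zero_add]
    exact sup_le (hg.1 hx) (inf_le_left.trans (abs_of_nonneg hg0).le)
  exact le_antisymm ((le_sub_self_iff g).1 h1) hc0

theorem subset_disjointCompl_disjointCompl (G : Set F) :
    G ⊆ disjointCompl (disjointCompl G) := fun x hx y hy => by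
  rw [inf_comm]
  exact hy x hx

theorem eq_zero_of_mem_disjointCompl {G : Set F} {x y : F} (hx : x ∈ disjointCompl G)
    (hy : y ∈ G) (h : |x| ≤ |y|) : x = 0 := by
  have := hx y hy
  rw [inf_eq_left.2 h] at this
  exact eq_zero_of_abs_le_zero this.le

/-- In an Archimedean vector lattice every band is its own second disjoint complement: a positive
`f ∈ B^{dd}` is the supremum of the elements of `B` in `[0, f]`. -/
theorem IsBand.disjointCompl_disjointCompl_subset (hF : IsArchimedean F) {B : Submodule ℝ F}
    (hB : IsBand B) : disjointCompl (disjointCompl (B : Set F)) ⊆ B := by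
  intro f hf
  have hlub : IsLUB {b : F | b ∈ B ∧ 0 ≤ b ∧ b ≤ |f|} |f| := by
    refine ⟨fun b hb => hb.2.2, fun u hu => ?_⟩
    have hu0 : 0 ≤ u := hu ⟨B.zero_mem, le_rfl, abs_nonneg f⟩
    set w := (|f| - u)⁺ with hw
    have hw0 : 0 ≤ w := posPart_nonneg _
    have hwf : w ≤ |f| := posPart_sub_le_self (abs_nonneg f) hu0
    have hwd : w ∈ disjointCompl (B : Set F) := by
      intro b hb
      set c := |w| ⊓ |b| with hc
      have hc0 : 0 ≤ c := le_inf (abs_nonneg _) (abs_nonneg _)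
      have hcB : c ∈ B := hB.mem_of_le hc0 inf_le_right (hB.abs_mem hb)
      have hcw : c ≤ w := inf_le_left.trans (abs_of_nonneg hw0).le
      have key : ∀ n : ℕ, (n : ℝ) • c ≤ |f| := by
        intro n
        induction n with
        | zero => simp
        | succ n ih =>
          have h1 : (n : ℝ) • c ≤ u :=
            hu ⟨B.smul_mem _ hcB, smul_nonneg (Nat.cast_nonneg n) hc0, ih⟩
          have h2 : c ≤ |f| - |f| ⊓ u := by
            rw [inf_eq_sub_posPart_sub, sub_sub_cancel]; exact hcw
          rw [Nat.cast_succ, add_smul, one_smul]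
          exact (add_le_add (le_inf ih h1) h2).trans (by rw [add_sub_cancel])
      exact le_antisymm (hF.le_zero_of_forall_nsmul_le key) hc0
    have hwz : w = 0 := by
      have h1 := hf w hwd
      rw [inf_eq_right.2 (by rwa [abs_of_nonneg hw0])] at h1
      exact eq_zero_of_abs_le_zero h1.le
    exact sub_nonpos.1 (posPart_eq_zero.1 hwz)
  have hne : {b : F | b ∈ B ∧ 0 ≤ b ∧ b ≤ |f|}.Nonempty := ⟨0, B.zero_mem, le_rfl, abs_nonneg f⟩
  have := hB.mem_of_isLUB hne (fun b hb => hb.1) hlub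
  exact hB.mem_of_abs_le this (by rw [abs_abs])

/-! ### Regular sublattices -/

/-- Regularity of a sublattice is tested on infima `0` of sets of positive elements. -/
theorem isRegularSublattice_of_lowerBound_le_zero {H : Submodule ℝ F} (hH : IsSublattice H)
    (h : ∀ G : Set F, G.Nonempty → (∀ x ∈ G, x ∈ H ∧ 0 ≤ x) →
      (∀ y ∈ H, 0 ≤ y → y ∈ lowerBounds G → y = 0) → ∀ e, 0 ≤ e → e ∈ lowerBounds G → e = 0) :
    IsRegularSublattice H where
  toIsSublattice := hH
  isLUB_coe G hne g hg := by
    have hub : (g : F) ∈ upperBounds ((fun x : H => (x : F)) '' G) := by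
      rintro _ ⟨x, hx, rfl⟩
      exact hg.1 hx
    refine ⟨hub, fun u hu => ?_⟩
    have key := h ((fun x : H => (g : F) - x) '' G) (hne.image _) ?_ ?_ (((g : F) - u)⁺)
      (posPart_nonneg _) ?_
    · exact sub_nonpos.1 (posPart_eq_zero.1 key)
    · rintro _ ⟨x, hx, rfl⟩
      exact ⟨H.sub_mem g.2 x.2, sub_nonneg.2 (hg.1 hx)⟩
    · intro y hy hy0 hyl
      have h1 : g ≤ g - ⟨y, hy⟩ := hg.2 fun x hx => by
        have : y ≤ (g : F) - x := hyl ⟨x, hx, rfl⟩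
        exact show (x : F) ≤ g - y from le_sub_comm.1 this
      have h2 : (g : F) ≤ g - y := h1
      exact le_antisymm ((le_sub_self_iff _).1 h2) hy0
    · rintro _ ⟨x, hx, rfl⟩
      exact sup_le (sub_le_sub_left (hu ⟨x, hx, rfl⟩) _) (sub_nonneg.2 (hg.1 hx))

theorem IsRegularSublattice.lowerBound_le_zero {H : Submodule ℝ F} (hH : IsRegularSublattice H)
    {G : Set F} (hne : G.Nonempty) (hG : ∀ x ∈ G, x ∈ H ∧ 0 ≤ x)
    (h : ∀ y ∈ H, 0 ≤ y → y ∈ lowerBounds G → y = 0) {e : F} (he : e ∈ lowerBounds G) :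
    e ≤ 0 := by
  have hlub : IsLUB {x : H | -(x : F) ∈ G} 0 := by
    refine ⟨fun x hx => ?_, fun u hu => ?_⟩
    · exact show (x : F) ≤ 0 from neg_nonneg.1 (hG _ hx).2
    · have := h (-(u : F))⁺ (hH.posPart_mem (H.neg_mem u.2)) (posPart_nonneg _) fun x hx =>
        sup_le (by
          have h1 : (⟨-x, H.neg_mem (hG x hx).1⟩ : H) ≤ u := hu (by simpa using hx)
          have h2 : -x ≤ (u : F) := h1
          exact neg_le.1 h2) (hG x hx).2
      exact show (0 : F) ≤ u from neg_nonpos.1 (posPart_eq_zero.1 this)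
  obtain ⟨a, ha⟩ := hne
  have := (hH.isLUB_coe _ ⟨⟨-a, H.neg_mem (hG a ha).1⟩, by simpa using ha⟩ 0 hlub).2
    (show -e ∈ _ by
      rintro _ ⟨x, hx, rfl⟩
      exact le_neg.1 (he hx))
  exact neg_nonneg.1 this

theorem IsOrderDense.isRegularSublattice {H : Submodule ℝ F} (hH : IsOrderDense H) :
    IsRegularSublattice H := by
  refine isRegularSublattice_of_lowerBound_le_zero hH.toIsSublattice ?_
  intro G _ _ h e he0 he
  by_contra hne
  obtain ⟨y, hy, hy0, hye⟩ := hH.exists_le e (lt_of_le_of_ne he0 (Ne.symm hne))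
  exact hy0.ne' (h y hy hy0.le fun x hx => hye.trans (he hx))

theorem isOrderDense_top : IsOrderDense (⊤ : Submodule ℝ F) where
  sup_mem _ _ _ _ := trivial
  inf_mem _ _ _ _ := trivial
  exists_le f hf := ⟨f, trivial, hf, le_rfl⟩

end VectorSpace

/-! ### Order continuous homomorphisms -/

section Homs

variable {F : Type*} [AddCommGroup F] [Lattice F] [IsOrderedAddMonoid F] [Module ℝ F]
  [IsOrderedModule ℝ F]
variable {E : Type*} [AddCommGroup E] [Lattice E] [IsOrderedAddMonoid E] [Module ℝ E]
  [IsOrderedModule ℝ E]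
variable {T : F →ₗ[ℝ] E}

theorem IsLatticeHom.monotone (hT : IsLatticeHom T) : Monotone T := fun x y h => by
  rw [← sup_eq_right, ← hT.map_sup, sup_eq_right.2 h]

theorem IsLatticeHom.map_nonneg (hT : IsLatticeHom T) {x : F} (h : 0 ≤ x) : 0 ≤ T x := by
  simpa using hT.monotone h

theorem IsLatticeHom.map_posPart (hT : IsLatticeHom T) (x : F) : T x⁺ = (T x)⁺ := by
  rw [posPart_def, posPart_def, hT.map_sup, map_zero]

theorem IsLatticeHom.map_abs (hT : IsLatticeHom T) (x : F) : T |x| = |T x| := by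
  rw [abs, abs, hT.map_sup, map_neg]

theorem IsSublattice.map (hT : IsLatticeHom T) {H : Submodule ℝ F} (hH : IsSublattice H) :
    IsSublattice (H.map T) := by
  refine isSublattice_of_posPart_mem ?_
  rintro _ ⟨x, hx, rfl⟩
  exact ⟨x⁺, hH.posPart_mem hx, hT.map_posPart x⟩

theorem IsSublattice.comap (hT : IsLatticeHom T) {H : Submodule ℝ E} (hH : IsSublattice H) :
    IsSublattice (H.comap T) := by
  refine isSublattice_of_posPart_mem fun x hx => ?_
  rw [Submodule.mem_comap, hT.map_posPart]
  exact hH.posPart_mem hx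

theorem IsLatticeHom.isSublattice_range (hT : IsLatticeHom T) :
    IsSublattice (LinearMap.range T) := by
  rw [LinearMap.range_eq_map]
  exact IsSublattice.map hT isOrderDense_top.toIsSublattice

theorem IsIdeal.comap (hT : IsLatticeHom T) {H : Submodule ℝ E} (hH : IsIdeal H) :
    IsIdeal (H.comap T) := by
  refine isIdeal_of_mem_of_abs_le fun x y hy hxy => hH.mem_of_abs_le (y := T y) hy ?_
  rw [← hT.map_abs, ← hT.map_abs]
  exact hT.monotone hxy

theorem IsLatticeHom.isIdeal_ker (hT : IsLatticeHom T) : IsIdeal (LinearMap.ker T) := by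
  refine isIdeal_of_mem_of_abs_le fun x y hy hxy => ?_
  rw [LinearMap.mem_ker] at hy ⊢
  have h := hT.monotone hxy
  rw [hT.map_abs, hT.map_abs, hy, abs_zero] at h
  exact eq_zero_of_abs_le_zero h

theorem preservesSuprema_iff_isGLB_zero : PreservesSuprema T ↔
    ∀ G : Set F, G.Nonempty → IsGLB G 0 → IsGLB (T '' G) 0 := by
  constructor
  · intro h G hne hG
    have h1 : IsLUB (-G) 0 := by rwa [isLUB_neg, neg_zero]
    have h2 := h (-G) hne.neg 0 h1
    rw [Set.image_neg_of_apply_neg_eq_neg (fun x _ => map_neg T x), map_zero] at h2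
    simpa using isLUB_neg.1 h2
  · intro h G hne g hg
    rw [← isGLB_image_sub_iff]
    convert h _ (hne.image _) (isGLB_image_sub_iff.2 hg) using 1
    simp [Set.image_image]

/-- A criterion for preservation of suprema that only has to rule out positive lower bounds. -/
theorem preservesSuprema_of_lowerBound_eq_zero (hT : IsLatticeHom T)
    (h : ∀ G : Set F, G.Nonempty → IsGLB G 0 → ∀ e, 0 ≤ e → e ∈ lowerBounds (T '' G) → e = 0) :
    PreservesSuprema T := by
  rw [preservesSuprema_iff_isGLB_zero]
  intro G hne hG
  have h0 : (0 : E) ∈ lowerBounds (T '' G) := by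
    rintro _ ⟨x, hx, rfl⟩
    exact hT.map_nonneg (hG.1 hx)
  refine ⟨h0, fun e he => ?_⟩
  have := h G hne hG e⁺ (posPart_nonneg e) fun x hx => sup_le (he hx) (h0 hx)
  exact posPart_eq_zero.1 this

theorem IsOrderContinuous.preservesSuprema (hT : IsLatticeHom T) (h : IsOrderContinuous T) :
    PreservesSuprema T := by
  refine preservesSuprema_of_lowerBound_eq_zero hT fun G hne hG e he0 he => ?_
  have hd : IsDirectedOrder (infClosure G)ᵒᵈ := ⟨fun a b =>
    ⟨OrderDual.toDual ⟨a.ofDual.1 ⊓ b.ofDual.1, infClosed_infClosure a.ofDual.2 b.ofDual.2⟩,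
      inf_le_left, inf_le_right⟩⟩
  have hn : Nonempty (infClosure G)ᵒᵈ := hne.to_subtype.map fun x =>
    OrderDual.toDual ⟨x.1, subset_infClosure x.2⟩
  have hglb : IsGLB (infClosure G) 0 := isGLB_infClosure.2 hG
  have hconv : OrderConverges (fun x : (infClosure G)ᵒᵈ => x.ofDual.1) 0 := by
    refine ⟨(infClosure G)ᵒᵈ, inferInstance, hd, hn, fun x => x.ofDual.1, fun a b hab => hab,
      ?_, fun j => ⟨j, fun k hk => ?_⟩⟩
    · have h1 := hglb
      rw [← Subtype.range_coe (s := infClosure G)] at h1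
      exact h1
    · rw [zero_sub, abs_neg, abs_of_nonneg (hglb.1 k.ofDual.2)]
      exact hk
  have hle : infClosure G ⊆ {x | e ≤ T x} := by
    refine infClosure_min (fun x hx => he ⟨x, hx, rfl⟩) fun x hx y hy => ?_
    rw [Set.mem_ofPred_eq, hT.map_inf]
    exact le_inf hx hy
  obtain ⟨J, _, _, _, g, -, hg, hconv⟩ := h _ _ 0 hconv
  refine le_antisymm (hg.2 ?_) he0
  rintro _ ⟨j, rfl⟩
  obtain ⟨i, hi⟩ := hconv j
  have h1 := hi i le_rfl
  rw [map_zero, zero_sub, abs_neg] at h1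
  exact (hle i.ofDual.2).trans ((le_abs_self _).trans h1)

theorem PreservesSuprema.isOrderContinuous (hT : IsLatticeHom T) (h : PreservesSuprema T) :
    IsOrderContinuous T := by
  rw [preservesSuprema_iff_isGLB_zero] at h
  intro I _ _ _ f x hfx
  obtain ⟨J, _, _, _, g, hga, hg, hconv⟩ := hfx
  have hTg := h _ (Set.range_nonempty g) hg
  -- the image net is indexed by its range, whose elements live in the universe of `E`
  have hd : IsDirectedOrder (T '' Set.range g)ᵒᵈ := by
    refine ⟨?_⟩
    rintro ⟨_, _, ⟨i, rfl⟩, rfl⟩ ⟨_, _, ⟨j, rfl⟩, rfl⟩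
    obtain ⟨k, hik, hjk⟩ := exists_ge_ge i j
    exact ⟨OrderDual.toDual ⟨T (g k), g k, ⟨k, rfl⟩, rfl⟩, hT.monotone (hga hik),
      hT.monotone (hga hjk)⟩
  have hn : Nonempty (T '' Set.range g)ᵒᵈ := ((Set.range_nonempty g).image T).to_subtype
  refine ⟨(T '' Set.range g)ᵒᵈ, inferInstance, hd, hn, fun y => y.ofDual.1, fun a b hab => hab,
    ?_, ?_⟩
  · rw [← Set.image_id' (T '' Set.range g), Set.image_eq_range] at hTg
    exact hTg
  · rintro ⟨_, _, ⟨j, rfl⟩, rfl⟩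
    obtain ⟨i, hi⟩ := hconv j
    refine ⟨i, fun k hk => ?_⟩
    rw [← map_sub, ← hT.map_abs]
    exact hT.monotone (hi k hk)

theorem PreservesSuprema.isBand_comap (hT : IsLatticeHom T) (h : PreservesSuprema T)
    {H : Submodule ℝ E} (hH : IsBand H) : IsBand (H.comap T) := by
  refine isBand_of_mem_of_isLUB (IsIdeal.comap hT hH.toIsIdeal) fun G hne hG g hg => ?_
  refine hH.mem_of_isLUB (hne.image T) ?_ (h G hne g hg)
  rintro _ ⟨x, hx, rfl⟩
  exact (hG x hx).1

theorem PreservesSuprema.isBand_ker (hT : IsLatticeHom T) (h : PreservesSuprema T) :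
    IsBand (LinearMap.ker T) := by
  refine isBand_of_mem_of_isLUB hT.isIdeal_ker fun G hne hG g hg => ?_
  have h1 := h G hne g hg
  have h2 : T '' G = {0} := by
    rw [Set.image_congr fun x hx => LinearMap.mem_ker.1 (hG x hx).1, hne.image_const]
  rw [h2] at h1
  exact h1.unique isLUB_singleton

/-- Regular sublattices have regular images: if a positive set `G` in `T H` has infimum `0` in
`T H`, then the set `G'` of its positive preimages in `H` has infimum `0` in `H`. Indeed a lower
bound `h ≥ 0` of `G'` lies in the kernel, so that `G'` is stable under subtraction of `h`. -/
theorem PreservesSuprema.isRegularSublattice_map (hF : IsArchimedean F) (hT : IsLatticeHom T)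
    (h : PreservesSuprema T) {H : Submodule ℝ F} (hH : IsRegularSublattice H) :
    IsRegularSublattice (H.map T) := by
  refine isRegularSublattice_of_lowerBound_le_zero (IsSublattice.map hT hH.toIsSublattice) ?_
  intro G hne hG hG0 e he0 he
  set G' : Set F := {x | x ∈ H ∧ 0 ≤ x ∧ T x ∈ G} with hG'
  have hGG' : T '' G' = G := by
    refine Set.Subset.antisymm ?_ fun y hy => ?_
    · rintro _ ⟨x, hx, rfl⟩
      exact hx.2.2
    · obtain ⟨⟨x, hx, rfl⟩, hy0⟩ := hG y hy
      have hTx : T x⁺ = T x := by rw [hT.map_posPart, posPart_eq_self.2 hy0]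
      exact ⟨x⁺, ⟨hH.posPart_mem hx, posPart_nonneg x, by rwa [hTx]⟩, hTx⟩
  have hne' : G'.Nonempty := by
    rw [← Set.image_nonempty (f := T), hGG']
    exact hne
  have hzero : ∀ y ∈ H, 0 ≤ y → y ∈ lowerBounds G' → y = 0 := by
    intro y hy hy0 hyl
    have hTy : T y = 0 := by
      refine hG0 (T y) ⟨y, hy, rfl⟩ (hT.map_nonneg hy0) ?_
      rw [← hGG']
      rintro _ ⟨x, hx, rfl⟩
      exact hT.monotone (hyl hx)
    have key : ∀ n : ℕ, ∀ x ∈ G', (n : ℝ) • y ≤ x := by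
      intro n
      induction n with
      | zero => intro x hx; simpa using hx.2.1
      | succ n ih =>
        intro x hx
        have h1 : x - y ∈ G' :=
          ⟨H.sub_mem hx.1 hy, sub_nonneg.2 (hyl hx), by rw [map_sub, hTy, sub_zero]; exact hx.2.2⟩
        rw [Nat.cast_succ, add_smul, one_smul]
        exact le_sub_iff_add_le.1 (ih _ h1)
    obtain ⟨x, hx⟩ := hne'
    exact le_antisymm (hF.le_zero_of_forall_nsmul_le fun n => key n x hx) hy0
  have hglb : IsGLB G' 0 := ⟨fun x hx => hx.2.1, fun e he =>
    hH.lowerBound_le_zero hne' (fun x hx => ⟨hx.1, hx.2.1⟩) hzero he⟩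
  have h2 := preservesSuprema_iff_isGLB_zero.1 h G' hne' hglb
  rw [hGG'] at h2
  exact le_antisymm (h2.2 he) he0

theorem preservesSuprema_of_isBand_ker (hT : IsLatticeHom T) (hK : IsBand (LinearMap.ker T))
    (hR : IsRegularSublattice (LinearMap.range T)) : PreservesSuprema T := by
  refine preservesSuprema_of_lowerBound_eq_zero hT fun G hne hG e he0 he => ?_
  refine le_antisymm (hR.lowerBound_le_zero (hne.image T) ?_ ?_ he) he0
  · rintro _ ⟨x, hx, rfl⟩
    exact ⟨⟨x, rfl⟩, hT.map_nonneg (hG.1 hx)⟩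
  · rintro _ ⟨x, rfl⟩ hx0 hxl
    -- `x⁺` is the supremum of the elements `(x⁺ - g)⁺` of the kernel
    have hTx : T x⁺ = T x := by rw [hT.map_posPart, posPart_eq_self.2 hx0]
    have hlub : IsLUB ((fun g => (x⁺ - g)⁺) '' G) x⁺ := by
      refine ⟨?_, fun u hu => ?_⟩
      · rintro _ ⟨g, hg, rfl⟩
        exact posPart_sub_le_self (posPart_nonneg x) (hG.1 hg)
      · exact sub_nonpos.1 (hG.2 fun g hg =>
          sub_le_comm.1 ((le_posPart _).trans (hu ⟨g, hg, rfl⟩)))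
    have := hK.mem_of_isLUB (hne.image _) ?_ hlub
    · rw [← hTx]
      exact this
    · rintro _ ⟨g, hg, rfl⟩
      rw [LinearMap.mem_ker, hT.map_posPart, map_sub, hTx, posPart_eq_zero, sub_nonpos]
      exact hxl ⟨g, hg, rfl⟩

theorem image_disjointCompl_subset_of_isBand_comap (hF : IsArchimedean F)
    (h : ∀ H : Submodule ℝ E, IsBand H → IsBand (H.comap T)) (G : Set F) :
    T '' disjointCompl (disjointCompl G) ⊆ disjointCompl (disjointCompl (T '' G)) := by
  rw [Set.image_subset_iff]
  have hB := h _ (isBand_disjointComplSubmodule (disjointCompl (T '' G)))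
  refine Set.Subset.trans ?_ (hB.disjointCompl_disjointCompl_subset hF)
  have hG : G ⊆ (disjointComplSubmodule (disjointCompl (T '' G))).comap T := fun x hx =>
    subset_disjointCompl_disjointCompl _ ⟨x, hx, rfl⟩
  exact fun x hx y hy => hx y fun z hz => hy z (hG hz)

/-- If `inf G = 0` and `0 ≤ e ≤ T G`, fix `a ∈ G` and `ε > 0`. The element `d = (e - ε T a)⁺` is
disjoint from all `T (ε a - g)⁺`, `g ∈ G`, and these positive parts have supremum `ε a`. Thus
the ideal `{x | T x ⊥ d}` has `a` in its second disjoint complement, so `T a`, which dominates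
`d`, is disjoint from `d`. -/
theorem preservesSuprema_of_image_disjointCompl_subset (hE : IsArchimedean E)
    (hT : IsLatticeHom T)
    (h : ∀ G : Submodule ℝ F, IsIdeal G → T '' disjointCompl (disjointCompl (G : Set F)) ⊆
      disjointCompl (disjointCompl (T '' (G : Set F)))) : PreservesSuprema T := by
  refine preservesSuprema_of_lowerBound_eq_zero hT fun G hne hG e he0 he => ?_
  obtain ⟨a, ha⟩ := hne
  have ha0 : 0 ≤ a := hG.1 ha
  refine le_antisymm (hE.le_zero_of_forall_smul_le (e := T a) fun ε hε => ?_) he0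
  set d := (e - ε • T a)⁺ with hd
  have hd0 : 0 ≤ d := posPart_nonneg _
  have hda : d ≤ T a := (posPart_sub_le_self he0
    (smul_nonneg hε.le (hT.map_nonneg ha0))).trans (he ⟨a, ha, rfl⟩)
  set B := (disjointComplSubmodule {d}).comap T with hB
  have hBi : IsIdeal B := IsIdeal.comap hT (isBand_disjointComplSubmodule {d}).toIsIdeal
  have hmem : ∀ g ∈ G, (ε • a - g)⁺ ∈ B := by
    intro g hg y hy
    rw [Set.mem_singleton_iff.1 hy, hT.map_posPart, map_sub, map_smul,
      abs_of_nonneg (posPart_nonneg _), abs_of_nonneg hd0]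
    refine le_antisymm ?_ (le_inf (posPart_nonneg _) hd0)
    rw [← inf_posPart_sub_eq_zero (a := ε • T a) (b := T g)]
    exact inf_le_inf_left _ (sup_le_sup_right (sub_le_sub_right (he ⟨g, hg, rfl⟩) _) _)
  have hlub : IsLUB ((fun g => (ε • a - g)⁺) '' G) (ε • a) := by
    refine ⟨?_, fun u hu => ?_⟩
    · rintro _ ⟨g, hg, rfl⟩
      exact posPart_sub_le_self (smul_nonneg hε.le ha0) (hG.1 hg)
    · exact sub_nonpos.1 (hG.2 fun g hg =>
        sub_le_comm.1 ((le_posPart _).trans (hu ⟨g, hg, rfl⟩)))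
  have hdd : a ∈ disjointComplSubmodule (disjointCompl (B : Set F)) := by
    have h1 : ε • a ∈ disjointComplSubmodule (disjointCompl (B : Set F)) := by
      refine (isBand_disjointComplSubmodule _).mem_of_isLUB (Set.Nonempty.image _ ⟨a, ha⟩) ?_ hlub
      rintro _ ⟨g, hg, rfl⟩
      exact subset_disjointCompl_disjointCompl _ (hmem g hg)
    exact (Submodule.smul_mem_iff _ hε.ne').1 h1
  have h2 := h B hBi ⟨a, hdd, rfl⟩ d (by
    rintro _ ⟨x, hx, rfl⟩
    rw [inf_comm]
    exact hx d rfl)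
  rw [abs_of_nonneg hd0, abs_of_nonneg (hT.map_nonneg ha0), inf_eq_right.2 hda] at h2
  exact sub_nonpos.1 (posPart_eq_zero.1 h2)

end Homs

/-! ### Disjoint sequences in infinite-dimensional principal ideals -/

section DisjointSequences

variable {E : Type*} [AddCommGroup E] [Lattice E] [IsOrderedAddMonoid E] [Module ℝ E]
  [IsOrderedModule ℝ E]

theorem isIdeal_principalIdeal (e : E) : IsIdeal (principalIdeal e) :=
  isIdeal_of_mem_of_abs_le fun _ _ ⟨a, ha, hy⟩ hxy => ⟨a, ha, hxy.trans hy⟩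

theorem self_mem_principalIdeal (e : E) : e ∈ principalIdeal e := ⟨1, zero_le_one, by simp⟩

theorem principalIdeal_mono {b e : E} (h : b ∈ principalIdeal e) :
    principalIdeal b ≤ principalIdeal e := by
  rintro x ⟨c, hc, hx⟩
  obtain ⟨a, ha, hb⟩ := h
  refine ⟨c * a, mul_nonneg hc ha, hx.trans ?_⟩
  rw [mul_smul]
  exact smul_le_smul_of_nonneg_left hb hc

theorem inf_abs_eq_zero_of_mem_principalIdeal {a b e : E} (hb : b ∈ principalIdeal e)
    (h : |a| ⊓ |e| = 0) : |a| ⊓ |b| = 0 := by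
  obtain ⟨c, hc, hb⟩ := hb
  rw [inf_comm] at h ⊢
  refine inf_abs_eq_zero_of_le (smul_inf_abs_eq_zero c h) ?_
  rwa [abs_smul_eq, abs_of_nonneg hc]

theorem pos_inf_of_mem_principalIdeal {a e : E} (ha : 0 < a) (he : 0 ≤ e)
    (h : a ∈ principalIdeal e) : 0 < a ⊓ e := by
  refine lt_of_le_of_ne (le_inf ha.le he) fun h0 => ha.ne' ?_
  have h1 : |a| ⊓ |e| = 0 := by rw [abs_of_nonneg ha.le, abs_of_nonneg he, ← h0]
  have h2 := inf_abs_eq_zero_of_mem_principalIdeal h h1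
  rw [inf_idem] at h2
  exact eq_zero_of_abs_le_zero h2.le

/-- The Riesz decomposition property, relative to a sublattice `L`. -/
theorem inf_principalIdeal_le_sup {L : Submodule ℝ E} (hL : IsSublattice L) {e p q : E}
    (hp : p ∈ L) (hp0 : 0 ≤ p) (hq0 : 0 ≤ q) (he : e ∈ principalIdeal (p + q)) :
    L ⊓ principalIdeal e ≤ (L ⊓ principalIdeal p) ⊔ (L ⊓ principalIdeal q) := by
  rintro y ⟨hyL, hye⟩
  obtain ⟨c, hc, hy⟩ := principalIdeal_mono he hye
  rw [abs_of_nonneg (add_nonneg hp0 hq0), smul_add] at hy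
  have hP0 : 0 ≤ c • p := smul_nonneg hc hp0
  have hQ0 : 0 ≤ c • q := smul_nonneg hc hq0
  have hPL : c • p ∈ L := L.smul_mem c hp
  set P := c • p
  set Q := c • q
  set z := (y ⊓ P) ⊔ (-P) with hz
  have hzL : z ∈ L := hL.sup_mem (hL.inf_mem hyL hPL) (L.neg_mem hPL)
  have hzP : |z| ≤ P := abs_le'.2
    ⟨sup_le inf_le_right (neg_le_self hP0), neg_le.1 le_sup_right⟩
  have hyz : |y - z| ≤ Q := by
    refine abs_le'.2 ⟨?_, ?_⟩
    · have h1 : y - z ≤ y - y ⊓ P := sub_le_sub_left le_sup_left y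
      refine h1.trans ?_
      rw [inf_eq_sub_posPart_sub, sub_sub_cancel]
      exact sup_le (sub_le_iff_le_add'.2 ((le_abs_self y).trans hy)) hQ0
    · rw [neg_sub, sub_le_iff_le_add]
      refine sup_le (inf_le_left.trans (le_add_of_nonneg_left hQ0)) ?_
      have h1 : -(P + Q) ≤ y := neg_le.1 ((neg_le_abs y).trans hy)
      rw [neg_add, ← sub_eq_add_neg] at h1
      exact sub_le_iff_le_add'.1 h1
  rw [← add_sub_cancel z y]
  exact Submodule.add_mem_sup
    ⟨hzL, c, hc, by rwa [abs_of_nonneg hp0]⟩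
    ⟨L.sub_mem hyL hzL, c, hc, by rwa [abs_of_nonneg hq0]⟩

/-- An element `x` of the principal ideal of `e` that is not a multiple of `e` is incomparable to
`e` at two different levels. -/
theorem exists_lt_not_smul_le_not_le_smul (hE : IsArchimedean E) {e x : E} (he : 0 < e)
    (hx : x ∈ principalIdeal e) (hxe : ∀ α : ℝ, x ≠ α • e) :
    ∃ s t : ℝ, s < t ∧ ¬ s • e ≤ x ∧ ¬ x ≤ t • e := by
  by_contra! hcon
  obtain ⟨C, hC, hxC⟩ := hx
  rw [abs_of_nonneg he.le] at hxC
  set A : Set ℝ := {t | t • e ≤ x} with hA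
  have hne : A.Nonempty := ⟨-C, by
    rw [hA, Set.mem_ofPred_eq, neg_smul]
    exact neg_le.1 ((neg_le_abs x).trans hxC)⟩
  have hbdd : BddAbove A := by
    refine ⟨C, fun t ht => ?_⟩
    by_contra! hlt
    have h1 : (t - C) • e ≤ 0 := by
      rw [sub_smul, sub_nonpos]
      exact (show t • e ≤ x from ht).trans ((le_abs_self x).trans hxC)
    have h2 := smul_le_smul_of_nonneg_left h1 (inv_nonneg.2 (sub_pos.2 hlt).le)
    rw [smul_smul, inv_mul_cancel₀ (sub_pos.2 hlt).ne', one_smul, smul_zero] at h2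
    exact he.not_ge h2
  refine hxe (sSup A) (le_antisymm ?_ ?_)
  · refine sub_nonpos.1 (hE.le_zero_of_forall_smul_le (e := e) fun ε hε => ?_)
    have h1 : ¬ (sSup A + ε / 2) • e ≤ x := fun h => by
      have := le_csSup hbdd h
      linarith
    have h2 := hcon (sSup A + ε / 2) (sSup A + ε) (by linarith) h1
    rwa [sub_le_iff_le_add', ← add_smul]
  · refine sub_nonpos.1 (hE.le_zero_of_forall_smul_le (e := e) fun ε hε => ?_)
    obtain ⟨t, ht, hlt⟩ := exists_lt_of_lt_csSup hne (sub_lt_self (sSup A) hε)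
    have h1 : (sSup A - ε) • e ≤ x :=
      (smul_le_smul_of_nonneg_right hlt.le he.le).trans ht
    rw [sub_smul] at h1
    exact sub_le_comm.1 h1

theorem exists_disjoint_of_not_finiteDimensional (hE : IsArchimedean E) {L : Submodule ℝ E}
    (hL : IsSublattice L) {e : E} (heL : e ∈ L) (he : 0 ≤ e)
    (hinf : ¬ FiniteDimensional ℝ ↥(L ⊓ principalIdeal e)) :
    ∃ a b : E, a ∈ L ∧ b ∈ L ∧ a ∈ principalIdeal e ∧ b ∈ principalIdeal e ∧ 0 < a ∧ 0 ≤ b ∧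
      a ⊓ b = 0 ∧ ¬ FiniteDimensional ℝ ↥(L ⊓ principalIdeal b) := by
  obtain ⟨x, ⟨hxL, hxI⟩, hxs⟩ : ∃ x ∈ L ⊓ principalIdeal e, x ∉ Submodule.span ℝ {e} := by
    by_contra! h
    exact hinf (Submodule.finiteDimensional_of_le (show _ ≤ Submodule.span ℝ {e} from h))
  have he0 : 0 < e := by
    refine lt_of_le_of_ne he fun h0 => hxs ?_
    obtain ⟨C, hC, hxC⟩ := hxI
    rw [← h0, abs_zero, smul_zero] at hxC
    rw [eq_zero_of_abs_le_zero hxC]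
    exact Submodule.zero_mem _
  obtain ⟨s, t, hst, hs, ht⟩ := exists_lt_not_smul_le_not_le_smul hE he0 hxI fun α hα =>
    hxs (Submodule.mem_span_singleton.2 ⟨α, hα.symm⟩)
  have hmem : ∀ r : ℝ, (x - r • e) ∈ L ∧ x - r • e ∈ principalIdeal e := fun r =>
    ⟨L.sub_mem hxL (L.smul_mem r heL),
      Submodule.sub_mem _ hxI (Submodule.smul_mem _ r (self_mem_principalIdeal e))⟩
  have hmem' : ∀ r : ℝ, (r • e - x) ∈ L ∧ r • e - x ∈ principalIdeal e := fun r => by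
    rw [← neg_sub]
    exact ⟨L.neg_mem (hmem r).1, Submodule.neg_mem _ (hmem r).2⟩
  have hI := (isIdeal_principalIdeal e).toIsSublattice
  by_cases hp : FiniteDimensional ℝ ↥(L ⊓ principalIdeal (x - s • e)⁺)
  · by_cases hq : FiniteDimensional ℝ ↥(L ⊓ principalIdeal (t • e - x)⁺)
    · -- `(t - s) e` is below the sum of the two positive parts
      refine absurd (Submodule.finiteDimensional_of_le (inf_principalIdeal_le_sup hL
        (hL.posPart_mem (hmem s).1) (posPart_nonneg (x - s • e)) (posPart_nonneg (t • e - x))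
        ?_)) hinf
      have h1 : (t - s) • e ≤ (x - s • e)⁺ + (t • e - x)⁺ := by
        refine le_trans (le_of_eq ?_) (add_le_add (le_posPart _) (le_posPart _))
        rw [sub_smul]
        abel
      refine ⟨(t - s)⁻¹, inv_nonneg.2 (sub_pos.2 hst).le, ?_⟩
      rw [abs_of_nonneg he, abs_of_nonneg (add_nonneg (posPart_nonneg _) (posPart_nonneg _))]
      have h2 := smul_le_smul_of_nonneg_left h1 (inv_nonneg.2 (sub_pos.2 hst).le)
      rwa [smul_smul, inv_mul_cancel₀ (sub_pos.2 hst).ne', one_smul] at h2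
    · refine ⟨(x - t • e)⁺, (t • e - x)⁺, hL.posPart_mem (hmem t).1, hL.posPart_mem (hmem' t).1,
        hI.posPart_mem (hmem t).2, hI.posPart_mem (hmem' t).2,
        lt_of_le_of_ne (posPart_nonneg _) fun h => ?_, posPart_nonneg _,
        inf_posPart_sub_eq_zero, hq⟩
      exact ht (sub_nonpos.1 (posPart_eq_zero.1 h.symm))
  · refine ⟨(s • e - x)⁺, (x - s • e)⁺, hL.posPart_mem (hmem' s).1, hL.posPart_mem (hmem s).1,
      hI.posPart_mem (hmem' s).2, hI.posPart_mem (hmem s).2,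
      lt_of_le_of_ne (posPart_nonneg _) fun h => ?_, posPart_nonneg _,
      inf_posPart_sub_eq_zero, hp⟩
    exact hs (sub_nonpos.1 (posPart_eq_zero.1 h.symm))

theorem exists_disjoint_sequence (hE : IsArchimedean E) {L : Submodule ℝ E}
    (hL : IsSublattice L) {e : E} (heL : e ∈ L) (he : 0 ≤ e)
    (hinf : ¬ FiniteDimensional ℝ ↥(L ⊓ principalIdeal e)) :
    ∃ w : ℕ → E, (∀ n, w n ∈ L ∧ 0 < w n ∧ w n ≤ e) ∧ Pairwise fun m n => w m ⊓ w n = 0 := by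
  let S := {b : E // b ∈ L ∧ 0 ≤ b ∧ ¬ FiniteDimensional ℝ ↥(L ⊓ principalIdeal b)}
  have step : ∀ b : S, ∃ p : E × S, p.1 ∈ L ∧ p.1 ∈ principalIdeal b.1 ∧
      p.2.1 ∈ principalIdeal b.1 ∧ 0 < p.1 ∧ p.1 ⊓ p.2.1 = 0 := fun b => by
    obtain ⟨a, c, haL, hcL, ha, hc, ha0, hc0, hac, hcinf⟩ :=
      exists_disjoint_of_not_finiteDimensional hE hL b.2.1 b.2.2.1 b.2.2.2
    exact ⟨⟨a, ⟨c, hcL, hc0, hcinf⟩⟩, haL, ha, hc, ha0, hac⟩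
  choose f hfL hfa hfb hf0 hfd using step
  let b : ℕ → S := fun n => Nat.rec ⟨e, heL, he, hinf⟩ (fun _ c => (f c).2) n
  have hb : ∀ n, b (n + 1) = (f (b n)).2 := fun n => rfl
  have hanti : Antitone fun n => principalIdeal (b n).1 :=
    antitone_nat_of_succ_le fun n => principalIdeal_mono (by rw [hb]; exact hfb _)
  have hdisj : ∀ m n, m < n → (f (b m)).1 ⊓ (f (b n)).1 = 0 := fun m n hmn => by
    have h1 : (f (b n)).1 ∈ principalIdeal (b (m + 1)).1 :=
      hanti (Nat.succ_le_of_lt hmn) (hfa (b n))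
    have h2 := inf_abs_eq_zero_of_mem_principalIdeal (a := (f (b m)).1) h1 (by
      rw [abs_of_nonneg (hf0 _).le, abs_of_nonneg (b (m + 1)).2.2.1, hb]
      exact hfd _)
    rwa [abs_of_nonneg (hf0 _).le, abs_of_nonneg (hf0 _).le] at h2
  have hpos : ∀ n, 0 < (f (b n)).1 ⊓ e := fun n =>
    pos_inf_of_mem_principalIdeal (hf0 _) he (hanti (Nat.zero_le n) (hfa (b n)))
  refine ⟨fun n => (f (b n)).1 ⊓ e, fun n => ⟨hL.inf_mem (hfL _) heL, hpos n, inf_le_right⟩, ?_⟩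
  intro m n hmn
  refine le_antisymm ((inf_le_inf inf_le_left inf_le_left).trans ?_)
    (le_inf (hpos m).le (hpos n).le)
  rcases lt_or_gt_of_ne hmn with h | h
  · exact (hdisj m n h).le
  · rw [inf_comm]
    exact (hdisj n m h).le

/-- The disjoint sequence can be kept away from some part `u` of a prescribed element `u₀ > 0`:
passing to a smaller `u₀` and to a tail, all `w n` are disjoint from `u₀`, and then
`u = (k u₀ - e)⁺` and `d = (e - k u₀)⁺` do for large `k`. -/
theorem exists_disjoint_sequence_disjoint_from (hE : IsArchimedean E) {L : Submodule ℝ E}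
    (hL : IsSublattice L) {e u₀ : E} (heL : e ∈ L) (he : 0 ≤ e) (hu₀L : u₀ ∈ L) (hu₀ : 0 < u₀)
    (hinf : ¬ FiniteDimensional ℝ ↥(L ⊓ principalIdeal e)) :
    ∃ (u d : E) (w : ℕ → E), u ∈ L ∧ 0 < u ∧ u ∈ principalIdeal u₀ ∧ d ∈ L ∧ 0 ≤ d ∧
      u ⊓ d = 0 ∧ (∀ n, w n ∈ L ∧ 0 < w n ∧ w n ≤ d) ∧ Pairwise fun m n => w m ⊓ w n = 0 := by
  obtain ⟨w, hw, hwd⟩ := exists_disjoint_sequence hE hL heL he hinf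
  obtain ⟨v, w', hvL, hv, hvu, hw', hwd', hvw⟩ : ∃ (v : E) (w' : ℕ → E), v ∈ L ∧ 0 < v ∧ v ≤ u₀ ∧
      (∀ n, w' n ∈ L ∧ 0 < w' n ∧ w' n ≤ e) ∧ (Pairwise fun m n => w' m ⊓ w' n = 0) ∧
      ∀ n, w' n ⊓ v = 0 := by
    by_cases h : ∀ n, w n ⊓ u₀ = 0
    · exact ⟨u₀, w, hu₀L, hu₀, le_rfl, hw, hwd, h⟩
    · push Not at h
      obtain ⟨m, hm⟩ := h
      have h0 : 0 ≤ w m ⊓ u₀ := le_inf (hw m).2.1.le hu₀.le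
      refine ⟨w m ⊓ u₀, fun n => w (n + (m + 1)), hL.inf_mem (hw m).1 hu₀L,
        lt_of_le_of_ne h0 hm.symm, inf_le_right, fun n => hw _,
        fun i j hij => hwd (by simpa using hij), fun n => ?_⟩
      refine le_antisymm ?_ (le_inf (hw _).2.1.le h0)
      exact (inf_le_inf_left _ inf_le_left).trans (hwd (by omega)).le
  obtain ⟨k, hk⟩ : ∃ k : ℕ, ¬ (k : ℝ) • v ≤ e := by
    by_contra! h
    exact hv.not_ge (hE.le_zero_of_forall_nsmul_le h)
  have hkL : (k : ℝ) • v ∈ L := L.smul_mem _ hvL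
  have hk0 : 0 ≤ (k : ℝ) • v := smul_nonneg (Nat.cast_nonneg k) hv.le
  refine ⟨((k : ℝ) • v - e)⁺, (e - (k : ℝ) • v)⁺, w', hL.posPart_mem (L.sub_mem hkL heL),
    lt_of_le_of_ne (posPart_nonneg _) fun h => hk (sub_nonpos.1 (posPart_eq_zero.1 h.symm)),
    ⟨k, Nat.cast_nonneg k, ?_⟩, hL.posPart_mem (L.sub_mem heL hkL), posPart_nonneg _,
    inf_posPart_sub_eq_zero, fun n => ⟨(hw' n).1, (hw' n).2.1, ?_⟩, hwd'⟩
  · rw [abs_of_nonneg (posPart_nonneg _), abs_of_nonneg hu₀.le]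
    exact (posPart_sub_le_self hk0 he).trans
      (smul_le_smul_of_nonneg_left hvu (Nat.cast_nonneg k))
  · refine le_posPart_sub_of_inf_eq_zero (hw' n).2.2 ?_
    have h1 := smul_inf_abs_eq_zero (x := v) (z := w' n) k (by
      rw [abs_of_nonneg hv.le, abs_of_nonneg (hw' n).2.1.le, inf_comm]
      exact hvw n)
    rwa [abs_of_nonneg hk0, abs_of_nonneg (hw' n).2.1.le, inf_comm] at h1

/-! ### A sublattice that is not regular -/

/-- The elements of `L` that are disjoint from `u` and from all but finitely many `w n`. -/
def eventuallyDisjoint (L : Submodule ℝ E) (u : E) (w : ℕ → E) : Submodule ℝ E where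
  carrier := {x | x ∈ L ∧ |x| ⊓ |u| = 0 ∧ ∃ N, ∀ n, N ≤ n → |x| ⊓ |w n| = 0}
  zero_mem' := ⟨L.zero_mem, by simp, 0, by simp⟩
  add_mem' := by
    rintro x y ⟨hx, hxu, N, hN⟩ ⟨hy, hyu, N', hN'⟩
    exact ⟨L.add_mem hx hy, add_inf_abs_eq_zero hxu hyu, max N N', fun n hn =>
      add_inf_abs_eq_zero (hN n (le_of_max_le_left hn)) (hN' n (le_of_max_le_right hn))⟩
  smul_mem' := by
    rintro c x ⟨hx, hxu, N, hN⟩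
    exact ⟨L.smul_mem c hx, smul_inf_abs_eq_zero c hxu, N, fun n hn =>
      smul_inf_abs_eq_zero c (hN n hn)⟩

theorem mem_eventuallyDisjoint_of_abs_le {L : Submodule ℝ E} {u : E} {w : ℕ → E} {x y : E}
    (hx : x ∈ L) (hy : y ∈ eventuallyDisjoint L u w) (h : |x| ≤ |y|) :
    x ∈ eventuallyDisjoint L u w := by
  obtain ⟨-, hyu, N, hN⟩ := hy
  exact ⟨hx, inf_abs_eq_zero_of_le hyu h, N, fun n hn => inf_abs_eq_zero_of_le (hN n hn) h⟩

/-- Below each `x > 0` of `L` disjoint from `u` there is a positive element of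
`eventuallyDisjoint L u w`: either `x` itself, or some `x ⊓ w m`. -/
theorem exists_mem_eventuallyDisjoint {L : Submodule ℝ E} (hL : IsSublattice L) {u : E}
    {w : ℕ → E} (hw : ∀ n, w n ∈ L ∧ 0 < w n) (hwd : Pairwise fun m n => w m ⊓ w n = 0)
    {x : E} (hx : x ∈ L) (hx0 : 0 < x) (hxu : |x| ⊓ |u| = 0) :
    x ∈ eventuallyDisjoint L u w ∨ ∃ m, 0 < x ⊓ w m ∧ x ⊓ w m ∈ eventuallyDisjoint L u w := by
  by_cases h : ∀ n, |x| ⊓ |w n| = 0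
  · exact Or.inl ⟨hx, hxu, 0, fun n _ => h n⟩
  · push Not at h
    obtain ⟨m, hm⟩ := h
    rw [abs_of_nonneg hx0.le, abs_of_nonneg (hw m).2.le] at hm
    have h0 : 0 ≤ x ⊓ w m := le_inf hx0.le (hw m).2.le
    refine Or.inr ⟨m, lt_of_le_of_ne h0 hm.symm, hL.inf_mem hx (hw m).1, ?_, m + 1,
      fun n hn => ?_⟩
    · refine inf_abs_eq_zero_of_le hxu ?_
      rw [abs_of_nonneg h0, abs_of_nonneg hx0.le]
      exact inf_le_left
    · refine inf_abs_eq_zero_of_le (y := w m) ?_ ?_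
      · rw [abs_of_nonneg (hw m).2.le, abs_of_nonneg (hw n).2.le]
        exact hwd (by omega)
      · rw [abs_of_nonneg h0, abs_of_nonneg (hw m).2.le]
        exact inf_le_right

theorem isSublattice_eventuallyDisjoint_sup_span {L : Submodule ℝ E} (hL : IsSublattice L) {u : E}
    {w : ℕ → E} {c : E} (hc : c ∈ L) (hc0 : 0 ≤ c) :
    IsSublattice (eventuallyDisjoint L u w ⊔ Submodule.span ℝ {c}) := by
  refine isSublattice_of_posPart_mem fun x hx => ?_
  obtain ⟨y, hy, z, hz, rfl⟩ := Submodule.mem_sup.1 hx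
  obtain ⟨α, rfl⟩ := Submodule.mem_span_singleton.1 hz
  have hαc : α • c ∈ L := L.smul_mem α hc
  rw [← sub_add_cancel (y + α • c)⁺ (α • c)⁺]
  refine Submodule.add_mem_sup (mem_eventuallyDisjoint_of_abs_le ?_ hy ?_) ?_
  · exact L.sub_mem (hL.posPart_mem (L.add_mem hy.1 hαc)) (hL.posPart_mem hαc)
  · have h := abs_sup_sub_sup_le_abs (y + α • c) (α • c) 0
    rwa [add_sub_cancel_right] at h
  · rcases le_total 0 α with h | h
    · rw [posPart_eq_self.2 (smul_nonneg h hc0)]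
      exact hz
    · rw [posPart_eq_zero.2 (smul_nonpos_of_nonpos_of_nonneg h hc0)]
      exact Submodule.zero_mem _

/-- With `I = eventuallyDisjoint L u w`, the elements of `I` in `[0, d]` have the upper bound `d` in
`E`, but their supremum in `I + ℝ (d + u)` is `d + u`. -/
theorem not_isRegularSublattice_eventuallyDisjoint_sup_span (hE : IsArchimedean E)
    {L : Submodule ℝ E} (hL : IsSublattice L) {u d : E} {w : ℕ → E}
    (hu : 0 < u) (hd : d ∈ L) (hd0 : 0 ≤ d) (hud : u ⊓ d = 0) (huL : u ∈ L)
    (hw : ∀ n, w n ∈ L ∧ 0 < w n ∧ w n ≤ d) (hwd : Pairwise fun m n => w m ⊓ w n = 0) :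
    ¬ IsRegularSublattice (eventuallyDisjoint L u w ⊔ Submodule.span ℝ {d + u}) := by
  intro hreg
  set I := eventuallyDisjoint L u w with hI
  set M := I ⊔ Submodule.span ℝ {d + u} with hM
  have hdu : |d| ⊓ |u| = 0 := by
    rw [abs_of_nonneg hd0, abs_of_nonneg hu.le, inf_comm]
    exact hud
  have hcM : d + u ∈ M := Submodule.mem_sup_right (Submodule.mem_span_singleton_self _)
  have hML : M ≤ L := sup_le (fun x hx => hx.1) ((Submodule.span_singleton_le_iff_mem _ _).2
    (L.add_mem hd huL))
  have hlub : IsLUB {x : M | (x : E) ∈ I ∧ (x : E) ≤ d} ⟨d + u, hcM⟩ := by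
    refine ⟨fun x hx => show (x : E) ≤ d + u from hx.2.trans (le_add_of_nonneg_right hu.le), ?_⟩
    rintro ⟨m, hm⟩ hmu
    have hmI : ∀ x ∈ I, x ≤ d → x ≤ m := fun x hx hxd =>
      hmu (show (⟨x, Submodule.mem_sup_left hx⟩ : M) ∈ _ from ⟨hx, hxd⟩)
    -- `d ≤ m` since `I` is order dense below `d`
    have hdm : d ≤ m := by
      have hm0 : 0 ≤ m := hmI 0 I.zero_mem hd0
      by_contra hcon
      have hz0 : 0 < (d - m)⁺ := lt_of_le_of_ne (posPart_nonneg _) fun h =>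
        hcon (sub_nonpos.1 (posPart_eq_zero.1 h.symm))
      have hzL : (d - m)⁺ ∈ L := hL.posPart_mem (L.sub_mem hd (hML hm))
      have hzu : |(d - m)⁺| ⊓ |u| = 0 := inf_abs_eq_zero_of_le hdu (by
        rw [abs_of_nonneg hz0.le, abs_of_nonneg hd0]
        exact posPart_sub_le_self hd0 hm0)
      obtain ⟨c, hcI, hc0, hcz⟩ : ∃ c ∈ I, 0 < c ∧ c ≤ (d - m)⁺ := by
        rcases exists_mem_eventuallyDisjoint hL (fun n => ⟨(hw n).1, (hw n).2.1⟩) hwd hzL hz0 hzu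
          with h | ⟨k, hk0, hkI⟩
        · exact ⟨_, h, hz0, le_rfl⟩
        · exact ⟨_, hkI, hk0, inf_le_left⟩
      have key : ∀ n : ℕ, (n : ℝ) • c ≤ d := by
        intro n
        induction n with
        | zero => simpa using hd0
        | succ n ih =>
          have h1 : (n : ℝ) • c ≤ d ⊓ m := le_inf ih (hmI _ (I.smul_mem _ hcI) ih)
          have h2 : c ≤ d - d ⊓ m := by
            rw [inf_eq_sub_posPart_sub, sub_sub_cancel]
            exact hcz
          rw [Nat.cast_succ, add_smul, one_smul]
          exact (add_le_add h1 h2).trans (by rw [add_sub_cancel])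
      exact hc0.not_ge (hE.le_zero_of_forall_nsmul_le key)
    obtain ⟨y, hy, z, hz, rfl⟩ := Submodule.mem_sup.1 hm
    obtain ⟨α, rfl⟩ := Submodule.mem_span_singleton.1 hz
    -- the component of `m - d` in the disjoint complement of `u` is positive
    set s := y + α • d - d with hs
    have hsu : |s| ⊓ |u| = 0 := by
      rw [hs, sub_eq_add_neg]
      refine add_inf_abs_eq_zero (add_inf_abs_eq_zero hy.2.1 (smul_inf_abs_eq_zero α hdu)) ?_
      rwa [abs_neg]
    have hsα : 0 ≤ s + α • u := by
      have h1 : s + α • u = y + α • (d + u) - d := by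
        rw [hs, smul_add]
        abel
      rw [h1]
      exact sub_nonneg.2 hdm
    have hs0 : 0 ≤ s := by
      have h1 : s⁻ ≤ |α| • |u| := by
        refine sup_le ?_ (smul_nonneg (abs_nonneg α) (abs_nonneg u))
        rw [← abs_smul_eq]
        exact (neg_le_iff_add_nonneg'.2 hsα).trans (le_abs_self _)
      have h2 : |s⁻| ⊓ |α • u| = 0 := by
        rw [inf_comm]
        rw [inf_comm] at hsu
        have h3 := smul_inf_abs_eq_zero α hsu
        rw [inf_comm] at h3 ⊢
        refine inf_abs_eq_zero_of_le h3 ?_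
        rw [abs_of_nonneg (negPart_nonneg s)]
        exact sup_le (neg_le_abs s) (abs_nonneg s)
      rw [abs_smul_eq, abs_of_nonneg (negPart_nonneg s), inf_eq_left.2 h1] at h2
      exact negPart_eq_zero.1 h2
    have hα : 1 ≤ α := by
      by_contra! hα
      obtain ⟨-, -, N, hN⟩ := hy
      have h1 : (1 - α) • d ≤ y := by
        rw [sub_smul, one_smul, sub_le_iff_le_add]
        exact sub_nonneg.1 hs0
      have h2 : |d| ⊓ |w N| = 0 := by
        have h3 : |(1 - α) • d| ⊓ |w N| = 0 := by
          refine inf_abs_eq_zero_of_le (hN N le_rfl) ?_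
          rw [abs_of_nonneg (smul_nonneg (sub_pos.2 hα).le hd0)]
          exact h1.trans (le_abs_self y)
        have h4 := smul_inf_abs_eq_zero (1 - α)⁻¹ h3
        rwa [smul_smul, inv_mul_cancel₀ (sub_pos.2 hα).ne', one_smul] at h4
      rw [abs_of_nonneg hd0, abs_of_nonneg (hw N).2.1.le, inf_eq_right.2 (hw N).2.2] at h2
      exact (hw N).2.1.ne' h2
    have h1 : y + α • (d + u) - (d + u) = s + (α - 1) • u := by
      rw [hs, smul_add, sub_smul, one_smul]
      abel
    have h2 : 0 ≤ y + α • (d + u) - (d + u) := by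
      rw [h1]
      exact add_nonneg hs0 (smul_nonneg (sub_nonneg.2 hα) hu.le)
    exact show d + u ≤ y + α • (d + u) from sub_nonneg.1 h2
  have hne : {x : M | (x : E) ∈ I ∧ (x : E) ≤ d}.Nonempty := ⟨0, I.zero_mem, hd0⟩
  have hle := (hreg.isLUB_coe _ hne _ hlub).2 (show d ∈ _ by
    rintro _ ⟨x, hx, rfl⟩
    exact hx.2)
  exact hu.not_ge ((add_le_iff_nonpos_right d).1 hle)

end DisjointSequences

/-! ### Images of order dense sublattices -/

section OrderDense

variable {F : Type*} [AddCommGroup F] [Lattice F] [IsOrderedAddMonoid F] [Module ℝ F]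
  [IsOrderedModule ℝ F]
variable {E : Type*} [AddCommGroup E] [Lattice E] [IsOrderedAddMonoid E] [Module ℝ E]
  [IsOrderedModule ℝ E]
variable {T : F →ₗ[ℝ] E}

theorem map_principalIdeal_le (hT : IsLatticeHom T) (f : F) :
    (principalIdeal f).map T ≤ LinearMap.range T ⊓ principalIdeal (T f) := by
  rintro _ ⟨x, ⟨a, ha, hx⟩, rfl⟩
  refine ⟨⟨x, rfl⟩, a, ha, ?_⟩
  have h := hT.monotone hx
  rwa [map_smul, hT.map_abs, hT.map_abs] at h

/-- Let `u` be a positive element dominated by a multiple of `T f₀`, where `f₀` is in the second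
disjoint complement of the kernel. A sublattice of `T F` that contains all the elements of `T F`
disjoint from `u` and from almost all `w n` has an order dense preimage: below `x > 0` there is either
a positive element of the kernel, or `x` is disjoint from the kernel, hence from `f₀`, and `T x` is
disjoint from `u`. -/
theorem isOrderDense_comap_of_eventuallyDisjoint_le (hT : IsLatticeHom T) {f₀ : F}
    (hf₀ : f₀ ∈ disjointCompl (disjointCompl (LinearMap.ker T : Set F))) {u : E} {w : ℕ → E}
    (hu : u ∈ principalIdeal (T f₀)) (hw : ∀ n, w n ∈ LinearMap.range T ∧ 0 < w n)
    (hwd : Pairwise fun m n => w m ⊓ w n = 0) {M : Submodule ℝ E} (hM : IsSublattice M)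
    (hIM : eventuallyDisjoint (LinearMap.range T) u w ≤ M) : IsOrderDense (M.comap T) where
  toIsSublattice := IsSublattice.comap hT hM
  exists_le x hx := by
    by_cases hxK : x ∈ disjointCompl (LinearMap.ker T : Set F)
    · have hTx : 0 < T x := by
        refine lt_of_le_of_ne (hT.map_nonneg hx.le) fun h => hx.ne' ?_
        exact eq_zero_of_mem_disjointCompl hxK (LinearMap.mem_ker.2 h.symm) le_rfl
      have hxu : |T x| ⊓ |u| = 0 := by
        refine inf_abs_eq_zero_of_mem_principalIdeal hu ?_
        rw [← hT.map_abs, ← hT.map_abs, ← hT.map_inf, inf_comm, hf₀ x hxK, map_zero]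
      rcases exists_mem_eventuallyDisjoint hT.isSublattice_range hw hwd ⟨x, rfl⟩ hTx hxu
        with h | ⟨m, hm0, hm⟩
      · exact ⟨x, hIM h, hx, le_rfl⟩
      · obtain ⟨⟨y, hy⟩, hwm⟩ := hw m
        have hTy : T (x ⊓ y⁺) = T x ⊓ w m := by
          rw [hT.map_inf, hT.map_posPart, hy, posPart_eq_self.2 hwm.le]
        refine ⟨x ⊓ y⁺, ?_, ?_, inf_le_left⟩
        · rw [Submodule.mem_comap, hTy]
          exact hIM hm
        · refine lt_of_le_of_ne (le_inf hx.le (posPart_nonneg y)) fun h => hm0.ne ?_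
          rw [← hTy, ← h, map_zero]
    · have h1 : ∃ k ∈ (LinearMap.ker T : Set F), |x| ⊓ |k| ≠ 0 := by
        by_contra! h
        exact hxK h
      obtain ⟨k, hk, hxk⟩ := h1
      rw [abs_of_nonneg hx.le] at hxk
      have h0 : 0 ≤ x ⊓ |k| := le_inf hx.le (abs_nonneg k)
      have h2 : x ⊓ |k| ∈ LinearMap.ker T :=
        hT.isIdeal_ker.mem_of_le h0 inf_le_right (hT.isIdeal_ker.abs_mem hk)
      refine ⟨x ⊓ |k|, ?_, lt_of_le_of_ne h0 hxk.symm, inf_le_left⟩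
      rw [Submodule.mem_comap, LinearMap.mem_ker.1 h2]
      exact M.zero_mem

theorem preservesSuprema_of_isRegularSublattice_map (hE : IsArchimedean E)
    (hT : IsLatticeHom T) {f : F} (hf : 0 ≤ f)
    (hinf : ¬ FiniteDimensional ℝ ((principalIdeal f).map T))
    (h : ∀ H : Submodule ℝ F, IsOrderDense H → IsRegularSublattice (H.map T)) :
    PreservesSuprema T := by
  have hR : IsRegularSublattice (LinearMap.range T) := by
    rw [LinearMap.range_eq_map]
    exact h ⊤ isOrderDense_top
  refine preservesSuprema_of_isBand_ker hT ?_ hR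
  have hB := isBand_disjointComplSubmodule (disjointCompl (LinearMap.ker T : Set F))
  suffices hsub : disjointComplSubmodule (disjointCompl (LinearMap.ker T : Set F)) =
      LinearMap.ker T by
    rwa [hsub] at hB
  refine le_antisymm (fun x hx => ?_) (subset_disjointCompl_disjointCompl _)
  by_contra hxK
  have hx0 : 0 < T |x| := by
    refine lt_of_le_of_ne (hT.map_nonneg (abs_nonneg x)) fun h0 => hxK ?_
    exact hT.isIdeal_ker.mem_of_abs_le (LinearMap.mem_ker.2 h0.symm) (abs_abs x).ge
  have hL := hT.isSublattice_range
  obtain ⟨u, d, w, huL, hu, hux, hd, hd0, hud, hw, hwd⟩ :=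
    exists_disjoint_sequence_disjoint_from hE hL ⟨f, rfl⟩ (hT.map_nonneg hf) ⟨|x|, rfl⟩ hx0
      fun hfin => hinf (Submodule.finiteDimensional_of_le (map_principalIdeal_le hT f))
  have hM : IsSublattice
      (eventuallyDisjoint (LinearMap.range T) u w ⊔ Submodule.span ℝ {d + u}) :=
    isSublattice_eventuallyDisjoint_sup_span hL (Submodule.add_mem _ hd huL)
      (add_nonneg hd0 hu.le)
  have hML : eventuallyDisjoint (LinearMap.range T) u w ⊔ Submodule.span ℝ {d + u} ≤
      LinearMap.range T := sup_le (fun y hy => hy.1)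
    ((Submodule.span_singleton_le_iff_mem _ _).2 (Submodule.add_mem _ hd huL))
  have hreg := h _ (isOrderDense_comap_of_eventuallyDisjoint_le hT (hB.abs_mem hx) hux
    (fun n => ⟨(hw n).1, (hw n).2.1⟩) hwd hM le_sup_left)
  rw [Submodule.map_comap_eq, inf_eq_right.2 hML] at hreg
  exact not_isRegularSublattice_eventuallyDisjoint_sup_span hE hL hu hd hd0 hud huL hw hwd hreg

theorem HasSigmaProperty.exists_not_finiteDimensional (hσ : HasSigmaProperty F)
    (hinf : ¬ FiniteDimensional ℝ (LinearMap.range T)) :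
    ∃ f : F, 0 ≤ f ∧ ¬ FiniteDimensional ℝ ((principalIdeal f).map T) := by
  obtain ⟨v, hv⟩ : ∃ v : ℕ → LinearMap.range T, LinearIndependent ℝ v := by
    let b := Module.Basis.ofVectorSpace ℝ (LinearMap.range T)
    have hι : Infinite (Module.Basis.ofVectorSpaceIndex ℝ (LinearMap.range T)) := by
      by_contra hfin
      rw [not_infinite_iff_finite] at hfin
      exact hinf (Module.Finite.of_basis b)
    exact ⟨_, b.linearIndependent.comp (Infinite.natEmbedding _) (Infinite.natEmbedding _).injective⟩
  choose x hx using fun n => (v n).2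
  obtain ⟨f, hf0, hf⟩ := hσ x
  refine ⟨f, hf0, fun hfin => ?_⟩
  have hli : LinearIndependent ℝ
      fun n => (⟨T (x n), x n, hf n, rfl⟩ : (principalIdeal f).map T) := by
    refine LinearIndependent.of_comp ((principalIdeal f).map T).subtype ?_
    have heq : ((principalIdeal f).map T).subtype ∘
        (fun n => (⟨T (x n), x n, hf n, rfl⟩ : (principalIdeal f).map T)) =
        (LinearMap.range T).subtype ∘ v := funext hx
    rw [heq]
    exact hv.map' (LinearMap.range T).subtype (Submodule.ker_subtype _)
  have := hli.finite
  exact not_finite ℕ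

end OrderDense

end VectorLattice

theorem theorem3p7
    {F : Type*} [AddCommGroup F] [Lattice F] [IsOrderedAddMonoid F] [Module ℝ F]
    [IsOrderedModule ℝ F]
    {E : Type*} [AddCommGroup E] [Lattice E] [IsOrderedAddMonoid E] [Module ℝ E]
    [IsOrderedModule ℝ E]
    (hF : IsArchimedean F) (hE : IsArchimedean E)
    (T : F →ₗ[ℝ] E) (hT : IsLatticeHom T) :
    List.TFAE
      [IsOrderContinuous T,
       PreservesSuprema T,
       IsBand (LinearMap.ker T) ∧ IsRegularSublattice (LinearMap.range T),
       ∀ H : Submodule ℝ E, IsBand H → IsBand (H.comap T),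
       ∀ G : Set F, T '' disjointCompl (disjointCompl G) ⊆ disjointCompl (disjointCompl (T '' G)),
       ∀ G : Submodule ℝ F, IsIdeal G →
         T '' disjointCompl (disjointCompl (G : Set F)) ⊆
           disjointCompl (disjointCompl (T '' (G : Set F)))] ∧
    ((∃ f : F, 0 ≤ f ∧ ¬ FiniteDimensional ℝ ((principalIdeal f).map T)) →
      List.TFAE
        [IsOrderContinuous T,
         ∀ H : Submodule ℝ F, IsRegularSublattice H → IsRegularSublattice (H.map T),
         ∀ H : Submodule ℝ F, IsOrderDense H → IsRegularSublattice (H.map T)]) ∧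
    (HasSigmaProperty F → ¬ FiniteDimensional ℝ (LinearMap.range T) →
      ∃ f : F, 0 ≤ f ∧ ¬ FiniteDimensional ℝ ((principalIdeal f).map T)) := by
  refine ⟨?_, fun ⟨f, hf, hinf⟩ => ?_, fun hσ hinf => hσ.exists_not_finiteDimensional hinf⟩
  · tfae_have 1 → 2 := IsOrderContinuous.preservesSuprema hT
    tfae_have 2 → 1 := PreservesSuprema.isOrderContinuous hT
    tfae_have 2 → 3 := fun h => ⟨h.isBand_ker hT, by
      rw [LinearMap.range_eq_map]
      exact h.isRegularSublattice_map hF hT isOrderDense_top.isRegularSublattice⟩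
    tfae_have 3 → 2 := fun h => preservesSuprema_of_isBand_ker hT h.1 h.2
    tfae_have 2 → 4 := fun h _ hH => h.isBand_comap hT hH
    tfae_have 4 → 5 := fun h G => image_disjointCompl_subset_of_isBand_comap hF h G
    tfae_have 5 → 6 := fun h G _ => h G
    tfae_have 6 → 2 := preservesSuprema_of_image_disjointCompl_subset hE hT
    tfae_finish
  · tfae_have 1 → 2 := fun h _ hH => (h.preservesSuprema hT).isRegularSublattice_map hF hT hH
    tfae_have 2 → 3 := fun h H hH => h H hH.isRegularSublattice
    tfae_have 3 → 1 := fun h =>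
      (preservesSuprema_of_isRegularSublattice_map hE hT hf hinf h).isOrderContinuous hT
    tfae_finish
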